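/- Theorem (Bochner Test). Let $n\ge 1$ and let $s=(s_\alpha)_{\alpha\in\mathbb{N}_0^n}$ be a real sequence such that $s_0=1$ and such that the power series $$f(z):=\sum_{\alpha\in\mathbb{N}_0^n}\frac{i^{|\alpha|}\,s_\alpha}{\alpha!}\,z^\alpha$$ is entire, i.e. converges absolutely for every $z\in\mathbb{C}^n$; here $|\alpha|=\alpha_1+\dots+\alpha_n$, $\alpha!=\alpha_1!\cdots\alpha_n!$ and $z^\alpha=z_1^{\alpha_1}\cdots z_n^{\alpha_n}$. Set $$f_1(z):=\sum_{|\alpha|\ \mathrm{odd}}\frac{i^{|\alpha|}\,s_\alpha}{\alpha!}\,z^\alpha,\qquad f_2(z):=\sum_{|\alpha|\ \mathrm{even}}\frac{i^{|\alpha|}\,s_\alpha}{\alpha!}\,z^\alpha .$$ For a complex square matrix $A$ write $A\succeq 0$ if $A$ is Hermitian and positive semidefinite, and write $A\succeq B$ if $A-B\succeq 0$. Then the following are equivalent: (i) $s$ is a determinate moment sequence, i.e. there is exactly one (non-negative) Borel measure $\mu$ on $\mathbb{R}^n$ such that for all $\alpha\in\mathbb{N}_0^n$ the monomial $x^\alpha$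 is $\mu$-integrable and $s_\alpha=\int_{\mathbb{R}^n}x^\alpha\,\mathrm{d}\mu(x)$. (ii) $\big(f(z_j-z_k)\big)_{j,k=1}^d\succeq 0$ for all $d\in\mathbb{N}$ and all $z_1,\dots,z_d\in\mathbb{R}^n$. (iii) For all $d\in\mathbb{N}$ and all $z_1,\dots,z_d\in\mathbb{R}^n$, $$\big(f_2(z_j-z_k)\big)_{j,k=1}^d\succeq 0\quad\text{and}\quad \big(f_2(z_j-z_k)\big)_{j,k=1}^d\succeq\big(f_1(z_j-z_k)\big)_{j,k=1}^d .$$ -/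

import Mathlib

open MeasureTheory
open scoped ComplexOrder

noncomputable section

namespace BochnerTest

/-- The order `|α| = α₁ + ⋯ + αₙ` of a multi-index. -/
def order {n : ℕ} (α : Fin n → ℕ) : ℕ := ∑ i, α i

/-- The multi-index factorial `α! = α₁! ⋯ αₙ!`. -/
def multiFactorial {n : ℕ} (α : Fin n → ℕ) : ℕ := ∏ i, (α i).factorial

/-- The term `i^|α| s_α z^α / α!` of the power series attached to a real multi-sequence `s`. -/
def term {n : ℕ} (s : (Fin n → ℕ) → ℝ) (z : Fin n → ℂ) (α : Fin n → ℕ) : ℂ :=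
  Complex.I ^ order α * (s α : ℂ) / (multiFactorial α : ℂ) * ∏ i, z i ^ α i

/-- The power series `∑_α i^|α| s_α z^α / α!` is entire: it converges (absolutely, which is the
same as unconditionally) at every point `z ∈ ℂⁿ`. -/
def IsEntire {n : ℕ} (s : (Fin n → ℕ) → ℝ) : Prop :=
  ∀ z : Fin n → ℂ, Summable fun α => term s z α

/-- `f(z) = ∑_α i^|α| s_α z^α / α!`. -/
def f {n : ℕ} (s : (Fin n → ℕ) → ℝ) (z : Fin n → ℂ) : ℂ :=
  ∑' α : Fin n → ℕ, term s z α

/-- The odd part `f₁` of `f`: the sum over all `α` with `|α|` odd. -/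
def f₁ {n : ℕ} (s : (Fin n → ℕ) → ℝ) (z : Fin n → ℂ) : ℂ :=
  ∑' α : {α : Fin n → ℕ // Odd (order α)}, term s z α

/-- The even part `f₂` of `f`: the sum over all `α` with `|α|` even. -/
def f₂ {n : ℕ} (s : (Fin n → ℕ) → ℝ) (z : Fin n → ℂ) : ℂ :=
  ∑' α : {α : Fin n → ℕ // Even (order α)}, term s z α

/-- The (non-negative, Borel) measure `μ` on `ℝⁿ` represents `s`: every monomial `x^α` is
`μ`-integrable and `s_α = ∫ x^α dμ(x)`. (For `α = 0` this forces `μ` to be finite.) -/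
def Represents {n : ℕ} (μ : Measure (EuclideanSpace ℝ (Fin n))) (s : (Fin n → ℕ) → ℝ) : Prop :=
  ∀ α : Fin n → ℕ, Integrable (fun x : EuclideanSpace ℝ (Fin n) => ∏ i, x i ^ α i) μ ∧
    ∫ x : EuclideanSpace ℝ (Fin n), ∏ i, x i ^ α i ∂μ = s α

/-- `s` is a determinate moment sequence: it has exactly one representing measure. -/
def IsDeterminateMomentSequence {n : ℕ} (s : (Fin n → ℕ) → ℝ) : Prop :=
  ∃! μ : Measure (EuclideanSpace ℝ (Fin n)), Represents μ s

/-- A point of `ℝⁿ` seen as a point of `ℂⁿ`. -/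
def toComplex {n : ℕ} (x : EuclideanSpace ℝ (Fin n)) : Fin n → ℂ := fun i => (x i : ℂ)

/-- The `d × d` matrix `(g(z_j - z_k))_{j,k}` for points `z_1, …, z_d ∈ ℝⁿ`. -/
def differenceMatrix {n d : ℕ} (g : (Fin n → ℂ) → ℂ)
    (z : Fin d → EuclideanSpace ℝ (Fin n)) : Matrix (Fin d) (Fin d) ℂ :=
  Matrix.of fun j k => g (toComplex (z j - z k))

end BochnerTest

end

/-!
If `μ` represents `s`, the even moments make `∏ i, cosh (t i * x i)` integrable, so expanding the
exponential under the integral identifies the characteristic function of `μ` with `f` on `ℝⁿ`.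
This gives uniqueness of `μ`, and positive definiteness of `f`.

Conversely, a continuous positive definite `φ` with `φ 0 = 1` is a characteristic function: the
integral of `φ` against a Gaussian is nonnegative (a standard Gaussian vector has the law of
`(X - Y) / √2` for independent copies `X`, `Y`, and positivity of the expectation of `φ (X - Y)` is
seen by averaging the matrix sums over many independent samples), hence Gaussian dampings of `φ`
have nonnegative Fourier transforms and are characteristic functions by Fourier inversion; tightness
yields the limit. If `charFun μ = f`, then the rescaled central differences of order `α` of `f` at
`0` tend to `i^|α| s_α`, while those of `charFun μ` are `i^|α|` times the integral of
`∏ i, (x i * sinc (h * x i / 2)) ^ α i`. Fatou's lemma for even exponents and then dominated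
convergence show that `μ` has the moments `s`.

For the last equivalence, `f₂ + f₁ = f` and `f₂ - f₁ = f (-·)`.
-/

namespace BochnerTest

open Filter Topology ProbabilityTheory
open scoped FourierTransform Matrix RealInnerProductSpace

section PositiveDefinite

variable {V W : Type*} [AddGroup V] [AddGroup W]

/-- `φ` is a positive definite function on the additive group `V`: all the matrices
`(φ (z_j - z_k))_{j,k}` are positive semidefinite. This is the hypothesis of Bochner's theorem. -/
def IsPosDefFun (φ : V → ℂ) : Prop :=
  ∀ (d : ℕ) (z : Fin d → V), (Matrix.of fun j k => φ (z j - z k)).PosSemidef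

lemma IsPosDefFun.comp_addMonoidHom {φ : W → ℂ} (h : IsPosDefFun φ) (g : V →+ W) :
    IsPosDefFun fun t => φ (g t) := by
  intro d z
  simpa only [map_sub, Function.comp_apply] using h d (g ∘ z)

lemma isPosDefFun_exp_mul_I : IsPosDefFun fun t : ℝ => Complex.exp (t * Complex.I) := by
  intro d z
  convert Matrix.posSemidef_vecMulVec_self_star fun j => Complex.exp (z j * Complex.I) using 1
  ext j k
  simp only [Matrix.of_apply, Matrix.vecMulVec_apply, Pi.star_apply, Complex.star_def,
    ← Complex.exp_conj, map_mul, Complex.conj_ofReal, Complex.conj_I, ← Complex.exp_add]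
  push_cast
  ring_nf

lemma IsPosDefFun.mul {φ ψ : V → ℂ} (hφ : IsPosDefFun φ) (hψ : IsPosDefFun ψ) :
    IsPosDefFun fun t => φ t * ψ t :=
  fun d z => (hφ d z).hadamard (hψ d z)

lemma IsPosDefFun.integral {X : Type*} [MeasurableSpace X] {μ : Measure X} {φ : X → V → ℂ}
    (hφ : ∀ x, IsPosDefFun (φ x)) (hint : ∀ t, Integrable (fun x => φ x t) μ) :
    IsPosDefFun fun t => ∫ x, φ x t ∂μ := by
  intro d z
  refine Matrix.posSemidef_iff_dotProduct_mulVec.2 ⟨?_, fun c => ?_⟩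
  · ext j k
    simp only [Matrix.conjTranspose_apply, Matrix.of_apply, Complex.star_def]
    rw [← integral_conj]
    exact integral_congr_ae (.of_forall fun x => (hφ x d z).1.apply j k)
  · have hpos : 0 ≤ ∫ x, star c ⬝ᵥ (Matrix.of fun j k => φ x (z j - z k)) *ᵥ c ∂μ :=
      integral_nonneg fun x => (hφ x d z).dotProduct_mulVec_nonneg c
    simp only [dotProduct, Matrix.mulVec, Matrix.of_apply, Finset.mul_sum] at hpos ⊢
    have hterm (j k) : Integrable (fun x => star c j * (φ x (z j - z k) * c k)) μ :=
      ((hint _).mul_const _).const_mul _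
    rw [integral_finsetSum _ fun j _ => integrable_finsetSum _ fun k _ => hterm j k] at hpos
    simpa only [integral_finsetSum _ fun k _ => hterm _ k, integral_const_mul,
      integral_mul_const] using hpos

lemma IsPosDefFun.sum_nonneg {φ : V → ℂ} (h : IsPosDefFun φ) {d : ℕ} (z : Fin d → V) :
    0 ≤ ∑ j, ∑ k, φ (z j - z k) := by
  simpa [dotProduct, Matrix.mulVec] using (h d z).dotProduct_mulVec_nonneg 1

lemma IsPosDefFun.apply_zero_nonneg {φ : V → ℂ} (h : IsPosDefFun φ) : 0 ≤ φ 0 := by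
  simpa using h.sum_nonneg (d := 1) 0

lemma IsPosDefFun.apply_neg {φ : V → ℂ} (h : IsPosDefFun φ) (t : V) : φ (-t) = star (φ t) := by
  simpa using ((h 2 ![t, 0]).1.apply 1 0).symm

lemma IsPosDefFun.norm_le {φ : V → ℂ} (h : IsPosDefFun φ) (t : V) : ‖φ t‖ ≤ ‖φ 0‖ := by
  have hdet := (h 2 ![t, 0]).det_nonneg
  simp only [Matrix.det_fin_two, Matrix.of_apply, Matrix.cons_val_zero, Matrix.cons_val_one,
    sub_self, sub_zero, zero_sub, h.apply_neg, Complex.star_def, Complex.mul_conj'] at hdet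
  rw [Complex.eq_coe_norm_of_nonneg h.apply_zero_nonneg, ← Complex.ofReal_mul,
    ← Complex.ofReal_pow, ← Complex.ofReal_sub, Complex.zero_le_real] at hdet
  nlinarith [norm_nonneg (φ t), norm_nonneg (φ 0)]

end PositiveDefinite

section CharFun

variable {V : Type*} [NormedAddCommGroup V] [InnerProductSpace ℝ V] [MeasurableSpace V]
  [BorelSpace V]

lemma isPosDefFun_charFun (μ : Measure V) [IsFiniteMeasure μ] : IsPosDefFun (charFun μ) :=
  .integral (fun x => isPosDefFun_exp_mul_I.comp_addMonoidHom (innerₗ V x).toAddMonoidHom)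
    fun t => (BoundedContinuousFunction.innerProbChar t).integrable μ

end CharFun

section Sampling

lemma measurePreserving_eval_prodMk {ι X : Type*} [Fintype ι] [MeasurableSpace X] (ν : Measure X)
    [IsProbabilityMeasure ν] {j k : ι} (hjk : j ≠ k) :
    MeasurePreserving (fun z : ι → X => (z j, z k)) (Measure.pi fun _ => ν) (ν.prod ν) := by
  refine ⟨by fun_prop, ?_⟩
  have hindep := (iIndepFun_pi (μ := fun _ : ι => ν) (X := fun _ x => x)
    fun _ => aemeasurable_id).indepFun hjk
  rw [indepFun_iff_map_prod_eq_prod_map_map (measurable_pi_apply j).aemeasurable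
    (measurable_pi_apply k).aemeasurable] at hindep
  simpa only [(measurePreserving_eval (fun _ : ι => ν) _).map_eq] using hindep

lemma nonneg_of_forall_nonneg_add_natCast_mul {a b : ℂ} (h : ∀ m : ℕ, 0 ≤ a + m * b) :
    0 ≤ b := by
  have hlim : Tendsto (fun m : ℕ => (m : ℂ)⁻¹ * a + b) atTop (𝓝 b) := by
    simpa using ((tendsto_inv_atTop_nhds_zero_nat (𝕜 := ℂ)).mul_const a).add_const b
  refine ge_of_tendsto hlim ((eventually_gt_atTop 0).mono fun m hm => ?_)
  have hm' : (m : ℂ) ≠ 0 := by exact_mod_cast hm.ne'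
  have : (m : ℂ)⁻¹ * a + b = (m : ℂ)⁻¹ * (a + m * b) := by field_simp
  rw [this]
  exact mul_nonneg (by positivity) (h m)

-- For independent samples `X₁, …, X_N` of `ν`, the expectation of `∑ j, ∑ k, K (X j) (X k)` is
-- `N` times the integral over the diagonal plus `N (N - 1)` times the double integral.
lemma integral_prod_nonneg_of_sum_nonneg {X : Type*} [MeasurableSpace X] (ν : Measure X)
    [IsProbabilityMeasure ν] {K : X → X → ℂ}
    (hK : Integrable (fun p : X × X => K p.1 p.2) (ν.prod ν))
    (hdiag : Integrable (fun x => K x x) ν)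
    (hpos : ∀ (d : ℕ) (z : Fin d → X), 0 ≤ ∑ j, ∑ k, K (z j) (z k)) :
    0 ≤ ∫ p, K p.1 p.2 ∂(ν.prod ν) := by
  set A := ∫ x, K x x ∂ν
  set B := ∫ p, K p.1 p.2 ∂(ν.prod ν)
  have hentry (m : ℕ) (j k : Fin (m + 1)) :
      Integrable (fun z : Fin (m + 1) → X => K (z j) (z k)) (Measure.pi fun _ => ν) ∧
        ∫ z, K (z j) (z k) ∂(Measure.pi fun _ => ν) = if j = k then A else B := by
    split_ifs with hjk
    · subst hjk
      have hj := measurePreserving_eval (fun _ : Fin (m + 1) => ν) j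
      exact ⟨hj.integrable_comp_of_integrable hdiag,
        hj.hasLaw.integral_comp hdiag.aestronglyMeasurable⟩
    · have hj := measurePreserving_eval_prodMk ν hjk
      exact ⟨hj.integrable_comp_of_integrable hK, hj.hasLaw.integral_comp hK.aestronglyMeasurable⟩
  refine nonneg_of_forall_nonneg_add_natCast_mul (a := A) fun m => ?_
  have hsum : ∫ z : Fin (m + 1) → X, ∑ j, ∑ k, K (z j) (z k) ∂(Measure.pi fun _ => ν) =
      (m + 1 : ℕ) * (A + m * B) := by
    rw [integral_finsetSum _ fun j _ => integrable_finsetSum _ fun k _ => (hentry m j k).1]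
    simp only [integral_finsetSum _ fun k _ => (hentry m _ k).1, (hentry m _ _).2]
    have hrow (j : Fin (m + 1)) : ∑ k, (if j = k then A else B) = A + m * B := by
      rw [← Finset.add_sum_erase _ _ (Finset.mem_univ j), if_pos rfl,
        Finset.sum_congr rfl fun k hk => if_neg (Finset.ne_of_mem_erase hk).symm]
      simp
    simp only [hrow, Finset.sum_const, Finset.card_univ, Fintype.card_fin, nsmul_eq_mul]
  refine le_of_mul_le_mul_left (a := ((m + 1 : ℕ) : ℂ)) ?_ (by positivity)
  rw [mul_zero, ← hsum]
  exact integral_nonneg fun z => hpos _ z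

end Sampling

section Gaussian

variable {V : Type*} [NormedAddCommGroup V] [InnerProductSpace ℝ V] [FiniteDimensional ℝ V]
  [MeasurableSpace V] [BorelSpace V]

lemma integrable_exp_neg_mul_sq_norm {b : ℝ} (hb : 0 < b) :
    Integrable fun v : V => Real.exp (-b * ‖v‖ ^ 2) := by
  have := (GaussianFourier.integrable_cexp_neg_mul_sq_norm_add (b := b) (by simpa using hb) 0
    (0 : V)).norm
  simpa [Complex.norm_exp, ← Complex.ofReal_pow] using this

lemma charFun_map_sub_prod (μ ν : Measure V) [SFinite μ] [SFinite ν] (t : V) :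
    charFun ((μ.prod ν).map fun p => p.1 - p.2) t = charFun μ t * charFun ν (-t) := by
  simp only [charFun_apply]
  rw [integral_map (by fun_prop) (by fun_prop), ← integral_prod_mul]
  refine integral_congr_ae (.of_forall fun p => ?_)
  simp only [inner_sub_left, inner_neg_right, ← Complex.exp_add]
  push_cast
  ring_nf

lemma map_sub_stdGaussian_prod :
    ((stdGaussian V).prod (stdGaussian V)).map (fun p => p.1 - p.2) =
      (stdGaussian V).map fun v => √2 • v := by
  have : IsFiniteMeasure (((stdGaussian V).prod (stdGaussian V)).map fun p => p.1 - p.2) :=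
    Measure.isFiniteMeasure_map _ _
  refine Measure.ext_of_charFun <| funext fun t => ?_
  rw [charFun_map_sub_prod, charFun_map_smul, charFun_stdGaussian, charFun_stdGaussian,
    charFun_stdGaussian, ← Complex.exp_add, norm_neg, norm_smul,
    Real.norm_of_nonneg (by positivity)]
  congr 1
  rw [← Complex.ofReal_pow (√2 * ‖t‖), mul_pow, Real.sq_sqrt zero_le_two]
  push_cast
  ring

lemma IsPosDefFun.integral_stdGaussian_nonneg {φ : V → ℂ} (h : IsPosDefFun φ)
    (hφ : Measurable φ) : 0 ≤ ∫ v, φ v ∂stdGaussian V := by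
  have hscale : IsPosDefFun fun v => φ ((√2)⁻¹ • v) :=
    h.comp_addMonoidHom (DistribSMul.toAddMonoidHom V (√2)⁻¹)
  have hmeas : Measurable fun v => φ ((√2)⁻¹ • v) := hφ.comp (measurable_const_smul _)
  have hlaw : ∫ p, φ ((√2)⁻¹ • (p.1 - p.2)) ∂(stdGaussian V).prod (stdGaussian V) =
      ∫ v, φ v ∂stdGaussian V := by
    rw [← integral_map (φ := fun p : V × V => p.1 - p.2) (f := fun v => φ ((√2)⁻¹ • v))
      (by fun_prop) hmeas.aestronglyMeasurable, map_sub_stdGaussian_prod,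
      integral_map (by fun_prop) hmeas.aestronglyMeasurable]
    simp [smul_smul]
  rw [← hlaw]
  refine integral_prod_nonneg_of_sum_nonneg (stdGaussian V) (K := fun x y => φ ((√2)⁻¹ • (x - y)))
    (Integrable.of_bound ?_ ‖φ 0‖ (.of_forall fun p => h.norm_le _)) (by simp) fun d z =>
      hscale.sum_nonneg z
  exact (hmeas.comp (measurable_fst.sub measurable_snd)).aestronglyMeasurable

lemma withDensity_gaussian_eq_smul_map_stdGaussian {b : ℝ} (hb : 0 < b) :
    (volume : Measure V).withDensity (fun v => ENNReal.ofReal (Real.exp (-b * ‖v‖ ^ 2))) =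
      ENNReal.ofReal ((Real.pi / b) ^ (Module.finrank ℝ V / 2 : ℝ)) •
        (stdGaussian V).map fun v => (√(2 * b))⁻¹ • v := by
  set c : ENNReal := ENNReal.ofReal ((Real.pi / b) ^ (Module.finrank ℝ V / 2 : ℝ)) with hc
  have hint : Integrable (fun v : V => Real.exp (-b * ‖v‖ ^ 2)) := integrable_exp_neg_mul_sq_norm hb
  have := isFiniteMeasure_withDensity_ofReal hint.2
  have := Measure.smul_finite ((stdGaussian V).map fun v => (√(2 * b))⁻¹ • v)
    (c := c) ENNReal.ofReal_ne_top
  refine Measure.ext_of_charFun <| funext fun t => ?_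
  have hdens (v : V) : (ENNReal.ofReal (Real.exp (-b * ‖v‖ ^ 2))).toReal •
      Complex.exp (⟪v, t⟫ * Complex.I) =
        Complex.exp (-b * ‖v‖ ^ 2 + Complex.I * ⟪t, v⟫) := by
    rw [ENNReal.toReal_ofReal (Real.exp_pos _).le, Complex.real_smul, Complex.ofReal_exp,
      ← Complex.exp_add, real_inner_comm]
    push_cast
    ring_nf
  have hscaled : charFun (c • (stdGaussian V).map fun v => (√(2 * b))⁻¹ • v) t =
      c.toReal • charFun (stdGaussian V) ((√(2 * b))⁻¹ • t) := by
    rw [charFun_apply, integral_smul_measure, ← charFun_apply, charFun_map_smul]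
  rw [hscaled, charFun_apply, integral_withDensity_eq_integral_toReal_smul (by fun_prop) (by simp)]
  simp only [hdens]
  rw [GaussianFourier.integral_cexp_neg_mul_sq_norm_add (by simpa using hb), charFun_stdGaussian,
    hc, ENNReal.toReal_ofReal (by positivity), Complex.real_smul, norm_smul,
    Complex.ofReal_cpow (by positivity), Real.norm_of_nonneg (by positivity)]
  rw [← Complex.ofReal_pow (_ * ‖t‖), mul_pow, inv_pow, Real.sq_sqrt (by positivity)]
  push_cast
  congr 2
  rw [Complex.I_sq]
  field_simp
  ring

lemma IsPosDefFun.integral_mul_gaussian_nonneg {φ : V → ℂ} (h : IsPosDefFun φ)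
    (hφ : Measurable φ) {b : ℝ} (hb : 0 < b) : 0 ≤ ∫ v, φ v * Real.exp (-b * ‖v‖ ^ 2) := by
  have hscale : IsPosDefFun fun v => φ ((√(2 * b))⁻¹ • v) :=
    h.comp_addMonoidHom (DistribSMul.toAddMonoidHom V (√(2 * b))⁻¹)
  have hdensity : ∫ v, φ v * Real.exp (-b * ‖v‖ ^ 2) = ∫ v, φ v ∂(volume : Measure V).withDensity
      fun v => ENNReal.ofReal (Real.exp (-b * ‖v‖ ^ 2)) := by
    rw [integral_withDensity_eq_integral_toReal_smul (by fun_prop) (by simp)]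
    simp [(Real.exp_pos _).le, mul_comm]
  rw [hdensity, withDensity_gaussian_eq_smul_map_stdGaussian hb, integral_smul_measure,
    integral_map (by fun_prop) hφ.aestronglyMeasurable]
  exact smul_nonneg ENNReal.toReal_nonneg
    (hscale.integral_stdGaussian_nonneg (hφ.comp (measurable_const_smul _)))

lemma IsPosDefFun.fourier_mul_gaussian_nonneg {φ : V → ℂ} (h : IsPosDefFun φ)
    (hφ : Measurable φ) {b : ℝ} (hb : 0 < b) (w : V) :
    0 ≤ 𝓕 (fun v => φ v * Real.exp (-b * ‖v‖ ^ 2)) w := by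
  have hchar : IsPosDefFun fun v : V => Complex.exp ((-(2 * Real.pi) * ⟪w, v⟫ : ℝ) * Complex.I) :=
    isPosDefFun_exp_mul_I.comp_addMonoidHom (-(2 * Real.pi) • innerₗ V w).toAddMonoidHom
  convert (hchar.mul h).integral_mul_gaussian_nonneg (by fun_prop) hb using 1
  rw [Real.fourier_eq']
  refine integral_congr_ae (.of_forall fun v => ?_)
  simp only [smul_eq_mul, real_inner_comm, mul_assoc, neg_mul]

end Gaussian

section Fourier

lemma integrable_of_tendsto_integral_norm {X E ι : Type*} [MeasurableSpace X] {μ : Measure X}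
    [NormedAddCommGroup E] {l : Filter ι} [l.NeBot] [l.IsCountablyGenerated] {F : ι → X → E}
    {G : X → E} {L : ℝ} (hF : ∀ᶠ i in l, Integrable (F i) μ)
    (hFG : ∀ᵐ x ∂μ, Tendsto (fun i => F i x) l (𝓝 (G x)))
    (hL : Tendsto (fun i => ∫ x, ‖F i x‖ ∂μ) l (𝓝 L)) : Integrable G μ := by
  obtain ⟨u, hu, hFu⟩ := exists_seq_forall_of_frequently hF.frequently
  have hFuG : ∀ᵐ x ∂μ, Tendsto (fun k => F (u k) x) atTop (𝓝 (G x)) :=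
    hFG.mono fun x hx => hx.comp hu
  refine memLp_one_iff_integrable.1 ⟨aestronglyMeasurable_of_tendsto_ae atTop
    (fun k => (hFu k).aestronglyMeasurable) hFuG, ?_⟩
  refine (Lp.eLpNorm_lim_le_liminf_eLpNorm
    (fun k => (hFu k).aestronglyMeasurable) G hFuG).trans_lt ?_
  have hnorm (k : ℕ) : eLpNorm (F (u k)) 1 μ = ENNReal.ofReal (∫ x, ‖F (u k) x‖ ∂μ) := by
    rw [eLpNorm_one_eq_lintegral_enorm, ofReal_integral_norm_eq_lintegral_enorm (hFu k)]
  have hLu : Tendsto (fun k => ∫ x, ‖F (u k) x‖ ∂μ) atTop (𝓝 L) := hL.comp hu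
  rw [funext hnorm, (ENNReal.tendsto_ofReal hLu).liminf_eq]
  exact ENNReal.ofReal_lt_top

variable {V : Type*} [NormedAddCommGroup V] [InnerProductSpace ℝ V] [FiniteDimensional ℝ V]
  [MeasurableSpace V] [BorelSpace V]

lemma tendsto_exp_neg_inv_mul (x : ℝ) :
    Tendsto (fun n : ℕ => Real.exp (-(n + 1 : ℝ)⁻¹ * x)) atTop (𝓝 1) := by
  simpa using ((tendsto_one_div_add_atTop_nhds_zero_nat (𝕜 := ℝ)).neg.mul_const x).rexp

lemma tendsto_integral_exp_smul_fourier {E : Type*} [NormedAddCommGroup E] [NormedSpace ℂ E]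
    [CompleteSpace E] {g : V → E} (hg : Integrable g) (hcont : ContinuousAt g 0) :
    Tendsto (fun c : ℝ => ∫ w : V, (Real.exp (-c⁻¹ * ‖w‖ ^ 2) : ℂ) • 𝓕 g w) atTop
      (𝓝 (g 0)) := by
  refine (Real.tendsto_integral_gaussian_smul' hg hcont).congr' ?_
  filter_upwards [eventually_gt_atTop 0] with c hc
  have hint : Integrable fun w : V => (Real.exp (-c⁻¹ * ‖w‖ ^ 2) : ℂ) :=
    (integrable_exp_neg_mul_sq_norm (inv_pos.2 hc)).ofReal
  have hflip := VectorFourier.integral_fourierIntegral_smul_eq_flip (L := innerₗ V)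
    Real.continuous_fourierChar continuous_inner hint hg
  rw [flip_innerₗ] at hflip
  refine Eq.trans (integral_congr_ae (.of_forall fun w => ?_)) hflip
  have hgauss := fourier_gaussian_innerProductSpace (b := (c⁻¹ : ℂ))
    (by simpa [← Complex.ofReal_inv] using hc) w
  change _ = 𝓕 (fun v : V => (Real.exp (-c⁻¹ * ‖v‖ ^ 2) : ℂ)) w • g w
  push_cast
  rw [hgauss, zero_sub, norm_neg, div_inv_eq_mul, div_inv_eq_mul]
  ring_nf

lemma integrable_fourier_of_nonneg {g : V → ℂ} (hg : Integrable g) (hcont : ContinuousAt g 0)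
    (hpos : ∀ w, 0 ≤ 𝓕 g w) : Integrable (𝓕 g) := by
  set F : ℕ → V → ℂ := fun n w => (Real.exp (-(n + 1 : ℝ)⁻¹ * ‖w‖ ^ 2) : ℂ) • 𝓕 g w
  have hFnorm (n : ℕ) (w : V) : F n w = ‖F n w‖ := Complex.eq_coe_norm_of_nonneg <|
    mul_nonneg (Complex.zero_le_real.2 (Real.exp_pos _).le) (hpos w)
  have hcontF : Continuous (𝓕 g) :=
    VectorFourier.fourierIntegral_continuous Real.continuous_fourierChar continuous_inner hg
  have hbound (w : V) : ‖𝓕 g w‖ ≤ ∫ v, ‖g v‖ :=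
    VectorFourier.norm_fourierIntegral_le_integral_norm _ _ _ _ _
  refine integrable_of_tendsto_integral_norm (F := F) (l := atTop) (L := (g 0).re)
    (.of_forall fun n => ?_) (.of_forall fun w => ?_) ?_
  · exact ((integrable_exp_neg_mul_sq_norm (by positivity)).ofReal).mul_bdd
      hcontF.aestronglyMeasurable (.of_forall hbound)
  · simpa only [Complex.ofReal_one, one_smul] using
      (tendsto_exp_neg_inv_mul (‖w‖ ^ 2)).ofReal.smul_const (𝓕 g w)
  · have hlim : Tendsto (fun n : ℕ => ∫ w, F n w) atTop (𝓝 (g 0)) :=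
      (tendsto_integral_exp_smul_fourier hg hcont).comp
        (tendsto_atTop_add_const_right _ 1 tendsto_natCast_atTop_atTop)
    refine ((Complex.continuous_re.tendsto _).comp hlim).congr fun n => ?_
    rw [Function.comp_apply, integral_congr_ae (.of_forall (hFnorm n)), integral_complex_ofReal,
      Complex.ofReal_re]

lemma exists_charFun_eq_of_fourier_nonneg {g : V → ℂ} (hg : Integrable g) (hcont : Continuous g)
    (h0 : g 0 = 1) (hpos : ∀ w, 0 ≤ 𝓕 g w) :
    ∃ μ : ProbabilityMeasure V, charFun (μ : Measure V) = g := by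
  have hint : Integrable (𝓕 g) := integrable_fourier_of_nonneg hg hcont.continuousAt hpos
  have hdens : AEMeasurable (fun w => ‖𝓕 g w‖ₑ) (volume : Measure V) := hint.1.enorm
  set μ : Measure V :=
    ((volume : Measure V).withDensity fun w => ‖𝓕 g w‖ₑ).map fun w => (2 * Real.pi) • w
  have hchar : charFun μ = g := by
    ext t
    rw [charFun_map_smul, charFun_apply, integral_withDensity_eq_integral_toReal_smul₀ hdens
      (by simp), ← congrFun (hcont.fourierInv_fourier_eq hg hint) t, Real.fourierInv_eq']
    refine integral_congr_ae (.of_forall fun w => ?_)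
    simp only [toReal_enorm, Complex.real_smul, ← Complex.eq_coe_norm_of_nonneg (hpos w),
      inner_smul_right, smul_eq_mul, mul_comm]
  have hprob : IsProbabilityMeasure μ := by
    have huniv : ((μ.real Set.univ : ℝ) : ℂ) = 1 := by rw [← charFun_zero, hchar, h0]
    rw [Complex.ofReal_eq_one, measureReal_def, ENNReal.toReal_eq_one_iff] at huniv
    exact ⟨huniv⟩
  exact ⟨⟨μ, hprob⟩, hchar⟩

end Fourier

section Bochner

variable {V : Type*} [NormedAddCommGroup V] [InnerProductSpace ℝ V] [FiniteDimensional ℝ V]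
  [MeasurableSpace V] [BorelSpace V]

lemma exists_charFun_eq_of_tendsto {μ : ℕ → ProbabilityMeasure V} {φ : V → ℂ}
    (hφ : ContinuousAt φ 0)
    (hlim : ∀ t, Tendsto (fun n => charFun (μ n : Measure V) t) atTop (𝓝 (φ t))) :
    ∃ ν : ProbabilityMeasure V, charFun (ν : Measure V) = φ := by
  have htight := isTightMeasureSet_of_tendsto_charFun hφ hlim
  have hcompact : IsCompact (closure (Set.range μ)) :=
    isCompact_closure_of_isTightMeasureSet (by convert htight using 1; ext; simp)
  obtain ⟨ν, -, k, hk, hν⟩ := hcompact.tendsto_subseq fun n => subset_closure ⟨n, rfl⟩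
  exact ⟨ν, funext fun t => tendsto_nhds_unique
    (ProbabilityMeasure.tendsto_iff_tendsto_charFun.1 hν t) ((hlim t).comp hk.tendsto_atTop)⟩

theorem IsPosDefFun.exists_charFun_eq {φ : V → ℂ} (h : IsPosDefFun φ) (hφ : Continuous φ)
    (h0 : φ 0 = 1) : ∃ μ : ProbabilityMeasure V, charFun (μ : Measure V) = φ := by
  set g : ℕ → V → ℂ := fun n v => φ v * Real.exp (-(n + 1 : ℝ)⁻¹ * ‖v‖ ^ 2)
  have hint (n : ℕ) : Integrable (g n) :=
    (integrable_exp_neg_mul_sq_norm (by positivity)).ofReal.bdd_mul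
      hφ.aestronglyMeasurable (.of_forall h.norm_le)
  have happrox (n : ℕ) : ∃ μ : ProbabilityMeasure V, charFun (μ : Measure V) = g n :=
    exists_charFun_eq_of_fourier_nonneg (hint n) (by fun_prop) (by simp [g, h0])
      (h.fourier_mul_gaussian_nonneg hφ.measurable (by positivity))
  choose μ hμ using happrox
  refine exists_charFun_eq_of_tendsto (μ := μ) hφ.continuousAt fun t => ?_
  simpa only [hμ, Complex.ofReal_one, mul_one] using
    (tendsto_exp_neg_inv_mul (‖t‖ ^ 2)).ofReal.const_mul (φ t)

end Bochner

section PowerSeries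

lemma summable_norm_prod_pi {R : Type*} [NormedCommRing R] {n : ℕ} {κ : Fin n → Type*}
    {g : ∀ i, κ i → R} (hg : ∀ i, Summable fun k => ‖g i k‖) :
    Summable fun α : ∀ i, κ i => ‖∏ i, g i (α i)‖ := by
  induction n with
  | zero => exact (hasSum_fintype _).summable
  | succ n ih =>
    rw [← (Fin.consEquiv κ).summable_iff]
    simpa [Function.comp_def, Fin.prod_univ_succ, Fin.consEquiv] using
      (hg 0).mul_norm (ih fun i => hg i.succ)

lemma hasSum_prod_pi {R : Type*} [NormedCommRing R] [CompleteSpace R] {n : ℕ}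
    {κ : Fin n → Type*} {g : ∀ i, κ i → R} {S : Fin n → R} (hS : ∀ i, HasSum (g i) (S i))
    (hg : ∀ i, Summable fun k => ‖g i k‖) :
    HasSum (fun α : ∀ i, κ i => ∏ i, g i (α i)) (∏ i, S i) := by
  induction n with
  | zero => simp
  | succ n ih =>
    have htail := summable_norm_prod_pi fun i => hg i.succ
    rw [Fin.prod_univ_succ, ← (Fin.consEquiv κ).hasSum_iff]
    simpa [Function.comp_def, Fin.prod_univ_succ, Fin.consEquiv] using
      (hS 0).mul (ih (fun i => hS i.succ) fun i => hg i.succ) ((hg 0).mul_norm htail).of_norm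

variable {n : ℕ} {s : (Fin n → ℕ) → ℝ}

lemma hasSum_prod_pow_div_multiFactorial {𝕂 : Type*} [RCLike 𝕂] (y : Fin n → 𝕂) :
    HasSum (fun α : Fin n → ℕ => (∏ i, y i ^ α i) / multiFactorial α)
      (NormedSpace.exp (∑ i, y i)) := by
  simpa only [NormedSpace.exp_sum, multiFactorial, Finset.prod_div_distrib, Nat.cast_prod] using
    hasSum_prod_pi (fun i => NormedSpace.expSeries_div_hasSum_exp (y i))
      fun i => NormedSpace.norm_expSeries_div_summable (y i)

lemma hasSum_prod_cosh (y : Fin n → ℝ) :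
    HasSum (fun α : Fin n → ℕ => (∏ i, y i ^ (2 * α) i) / multiFactorial (2 * α))
      (∏ i, Real.cosh (y i)) := by
  simpa only [multiFactorial, Finset.prod_div_distrib, Nat.cast_prod, Pi.mul_apply,
    Pi.ofNat_apply] using hasSum_prod_pi (fun i => Real.hasSum_cosh (y i))
      fun i => (Real.hasSum_cosh (y i)).summable.norm

lemma norm_term (z : Fin n → ℂ) (α : Fin n → ℕ) :
    ‖term s z α‖ = |s α| / multiFactorial α * ∏ i, ‖z i‖ ^ α i := by
  simp [term]

lemma term_smul (c : ℂ) (z : Fin n → ℂ) (α : Fin n → ℕ) :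
    term s (c • z) α = c ^ order α * term s z α := by
  simp only [term, order, Pi.smul_apply, smul_eq_mul, mul_pow, Finset.prod_mul_distrib,
    Finset.prod_pow_eq_pow_sum]
  ring

lemma continuous_f_toComplex (hs : IsEntire s) :
    Continuous fun x : EuclideanSpace ℝ (Fin n) => f s (toComplex x) := by
  refine continuous_iff_continuousAt.2 fun x₀ => ?_
  suffices ContinuousOn (fun x : EuclideanSpace ℝ (Fin n) => f s (toComplex x))
      (Metric.ball x₀ 1) from this.continuousAt (Metric.ball_mem_nhds x₀ one_pos)
  refine continuousOn_tsum (u := fun α => ‖term s (fun _ => ((‖x₀‖ + 1 : ℝ) : ℂ)) α‖)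
    (fun α => ?_) (hs _).norm fun α x hx => ?_
  · simp only [term, toComplex]
    fun_prop
  · have hx_norm : ‖x‖ ≤ ‖x₀‖ + 1 := by
      have := norm_sub_norm_le x x₀
      rw [mem_ball_iff_norm] at hx
      linarith
    rw [norm_term, norm_term]
    gcongr with i
    simp only [toComplex, Complex.norm_real]
    exact (PiLp.norm_apply_le x i).trans (hx_norm.trans (le_abs_self _))

lemma f_toComplex_zero : f s (toComplex 0) = s 0 := by
  rw [f, tsum_eq_single 0]
  · simp [term, order, multiFactorial]
  · intro α hα
    obtain ⟨i, hi⟩ := Function.ne_iff.1 hα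
    rw [term, Finset.prod_eq_zero (Finset.mem_univ i), mul_zero]
    simpa [toComplex] using hi

end PowerSeries

section CharFunOfMoments

lemma integrable_of_hasSum {X E ι : Type*} [MeasurableSpace X] {μ : Measure X}
    [NormedAddCommGroup E] [Countable ι] {F : ι → X → E} {G : X → E}
    (hF : ∀ i, Integrable (F i) μ) (hsum : Summable fun i => ∫ x, ‖F i x‖ ∂μ)
    (hG : ∀ᵐ x ∂μ, HasSum (fun i => F i x) (G x)) : Integrable G μ := by
  have hmeas : AEStronglyMeasurable G μ :=
    aestronglyMeasurable_of_tendsto_ae (u := atTop) (f := fun (t : Finset ι) x => ∑ i ∈ t, F i x)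
      (fun t => Finset.aestronglyMeasurable_fun_sum t fun i _ => (hF i).1) hG
  refine ⟨hmeas, ?_⟩
  calc ∫⁻ x, ‖G x‖ₑ ∂μ ≤ ∫⁻ x, ∑' i, ‖F i x‖ₑ ∂μ := by
        refine lintegral_mono_ae (hG.mono fun x hx => ?_)
        rw [← hx.tsum_eq]
        exact enorm_tsum_le_tsum_enorm
    _ = ∑' i, ENNReal.ofReal (∫ x, ‖F i x‖ ∂μ) := by
        rw [lintegral_tsum fun i => (hF i).1.enorm]
        simp only [ofReal_integral_norm_eq_lintegral_enorm (hF _)]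
    _ < ⊤ := hsum.tsum_ofReal_lt_top

variable {n : ℕ} {s : (Fin n → ℕ) → ℝ} {μ : Measure (EuclideanSpace ℝ (Fin n))}

lemma Represents.isFiniteMeasure (h : Represents μ s) : IsFiniteMeasure μ := by
  have h1 : Integrable (fun _ => (1 : ℝ)) μ := by simpa using (h 0).1
  exact (integrable_const_iff_isFiniteMeasure one_ne_zero).1 h1

lemma prod_mul_pow_div_eq {𝕂 : Type*} [Field 𝕂] (c y : Fin n → 𝕂) (α : Fin n → ℕ) :
    (∏ i, (c i * y i) ^ α i) / (multiFactorial α : 𝕂) =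
      (∏ i, c i ^ α i) / multiFactorial α * ∏ i, y i ^ α i := by
  simp only [mul_pow, Finset.prod_mul_distrib]
  ring

lemma Represents.integrable_prod_cosh (h : Represents μ s) (hs : IsEntire s) (t : Fin n → ℝ) :
    Integrable (fun x => ∏ i, Real.cosh (t i * x i)) μ := by
  refine integrable_of_hasSum (fun α => ?_) ?_ (.of_forall fun x =>
    hasSum_prod_cosh fun i => t i * x i)
  · simp only [prod_mul_pow_div_eq]
    exact (h _).1.const_mul _
  · have hnorm (α : Fin n → ℕ) : ∫ x : EuclideanSpace ℝ (Fin n),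
        ‖(∏ i, (t i * x i) ^ (2 * α) i) / (multiFactorial (2 * α) : ℝ)‖ ∂μ =
        ‖term s (fun i => (t i : ℂ)) (2 * α)‖ := by
      have hpos (y : Fin n → ℝ) : 0 ≤ ∏ i, y i ^ (2 * α) i :=
        Finset.prod_nonneg fun i _ => (even_two_mul (α i)).pow_nonneg _
      have hs_nonneg : 0 ≤ s (2 * α) := (h _).2 ▸ integral_nonneg fun x => hpos x
      simp only [prod_mul_pow_div_eq, norm_mul, norm_div, Real.norm_of_nonneg (hpos _),
        RCLike.norm_natCast, integral_const_mul, (h _).2, norm_term, abs_of_nonneg hs_nonneg,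
        Complex.norm_real, ← norm_pow, ← norm_prod]
      ring
    simp only [hnorm]
    exact (hs _).norm.comp_injective (mul_right_injective₀ (two_ne_zero' ℕ)).comp_left

lemma Represents.integrable_exp_sum_abs (h : Represents μ s) (hs : IsEntire s)
    (t : Fin n → ℝ) : Integrable (fun x => Real.exp (∑ i, |t i * x i|)) μ := by
  refine ((h.integrable_prod_cosh hs t).const_mul (2 ^ n)).mono'
    (Continuous.aestronglyMeasurable (by fun_prop)) (.of_forall fun x => ?_)
  rw [Real.norm_of_nonneg (Real.exp_pos _).le, Real.exp_sum]
  calc ∏ i, Real.exp |t i * x i| ≤ ∏ i, (2 * Real.cosh (t i * x i)) := by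
        gcongr with i
        rw [Real.cosh_eq]
        linarith [Real.exp_abs_le (t i * x i)]
    _ = 2 ^ n * ∏ i, Real.cosh (t i * x i) := by simp [Finset.prod_mul_distrib]

lemma Represents.integral_prod_pow_div (h : Represents μ s) (z : Fin n → ℂ) (α : Fin n → ℕ) :
    ∫ x : EuclideanSpace ℝ (Fin n),
      (∏ i, (Complex.I * z i * x i) ^ α i) / (multiFactorial α : ℂ) ∂μ = term s z α := by
  have hs : ∫ x : EuclideanSpace ℝ (Fin n), ∏ i, (x i : ℂ) ^ α i ∂μ = s α := by
    rw [← (h α).2, ← integral_complex_ofReal]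
    simp
  simp only [prod_mul_pow_div_eq]
  rw [integral_const_mul, hs, term]
  simp only [Finset.prod_pow_eq_pow_sum, order]
  ring

lemma Represents.charFun_eq (h : Represents μ s) (hs : IsEntire s) :
    charFun μ = fun t => f s (toComplex t) := by
  ext t
  have hinner (x : EuclideanSpace ℝ (Fin n)) :
      (inner ℝ x t : ℂ) * Complex.I = ∑ i, Complex.I * t i * x i := by
    simp [PiLp.inner_apply, Finset.mul_sum, mul_comm, mul_assoc]
  have hsum := hasSum_integral_of_dominated_convergence
    (F := fun (α : Fin n → ℕ) (x : EuclideanSpace ℝ (Fin n)) =>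
      (∏ i, (Complex.I * t i * x i) ^ α i) / (multiFactorial α : ℂ))
    (f := fun x => Complex.exp ((inner ℝ x t : ℝ) * Complex.I))
    (fun α x => (∏ i, |t i * x i| ^ α i) / (multiFactorial α : ℝ))
    (fun α => Continuous.aestronglyMeasurable (by fun_prop))
    (fun α => .of_forall fun x => by simp [mul_pow])
    (.of_forall fun x => (hasSum_prod_pow_div_multiFactorial _).summable)
    (by simpa only [(hasSum_prod_pow_div_multiFactorial _).tsum_eq, ← Real.exp_eq_exp_ℝ] using
      h.integrable_exp_sum_abs hs fun i => t i)
    (.of_forall fun x => by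
      rw [hinner, Complex.exp_eq_exp_ℂ]
      exact hasSum_prod_pow_div_multiFactorial _)
  rw [charFun_apply, ← hsum.tsum_eq, f]
  exact tsum_congr fun α => h.integral_prod_pow_div _ α

end CharFunOfMoments

section CentralDifference

variable {n : ℕ}

/-- The mixed central difference of order `α` of `F` at the origin, used to read off the coefficient
of order `α` of a power series. Steps are of unit length: the step `h` enters by rescaling `F`. -/
noncomputable def centralDiff {M : Type*} [AddCommGroup M] (α : Fin n → ℕ)
    (F : EuclideanSpace ℝ (Fin n) → M) : M :=
  ∑ j ∈ Fintype.piFinset fun i => Finset.range (α i + 1),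
    (∏ i, ((-1 : ℤ) ^ (α i - j i) * (α i).choose (j i))) •
      F (WithLp.toLp 2 fun i => -(α i / 2 : ℝ) + j i)

lemma centralDiff_prod {R : Type*} [CommRing R] (α : Fin n → ℕ) (g : Fin n → ℝ → R) :
    centralDiff α (fun x => ∏ i, g i (x i)) = ∏ i, (fwdDiff 1)^[α i] (g i) (-(α i / 2)) := by
  simp only [fwdDiff_iter_eq_sum_shift, Finset.prod_univ_sum, centralDiff, zsmul_eq_mul,
    Finset.prod_mul_distrib (f := fun _ => Int.cast _), Int.cast_prod, nsmul_one]

lemma map_centralDiff {M N : Type*} [AddCommGroup M] [AddCommGroup N] (φ : M →+ N)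
    (α : Fin n → ℕ) (F : EuclideanSpace ℝ (Fin n) → M) :
    centralDiff α (fun x => φ (F x)) = φ (centralDiff α F) := by
  simp only [centralDiff, map_sum, map_zsmul]

lemma integral_centralDiff {X : Type*} [MeasurableSpace X] {μ : Measure X} {E : Type*}
    [NormedAddCommGroup E] [NormedSpace ℝ E] (α : Fin n → ℕ)
    {F : EuclideanSpace ℝ (Fin n) → X → E} (hF : ∀ t, Integrable (F t) μ) :
    centralDiff α (fun t => ∫ x, F t x ∂μ) = ∫ x, centralDiff α (fun t => F t x) ∂μ := by
  simp only [centralDiff, ← Int.cast_smul_eq_zsmul ℝ, ← integral_smul]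
  exact (integral_finsetSum _ fun j _ => (hF _).smul _).symm

lemma hasSum_centralDiff {ι E : Type*} [NormedAddCommGroup E] (α : Fin n → ℕ)
    {F : ι → EuclideanSpace ℝ (Fin n) → E} {G : EuclideanSpace ℝ (Fin n) → E}
    (hF : ∀ t, HasSum (fun i => F i t) (G t)) :
    HasSum (fun i => centralDiff α (F i)) (centralDiff α G) :=
  hasSum_sum fun _ _ => (hF _).const_smul _

lemma centralDiff_prod_pow_of_not_le {α β : Fin n → ℕ}
    (h : ¬α ≤ β) : centralDiff α (fun x => ∏ i, x i ^ β i) = 0 := by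
  obtain ⟨i, hi⟩ : ∃ i, β i < α i := by simpa only [Pi.le_def, not_forall, not_le] using h
  rw [centralDiff_prod α fun i r => r ^ β i]
  refine Finset.prod_eq_zero (Finset.mem_univ i) ?_
  rw [fwdDiff_iter_pow_eq_zero_of_lt hi, Pi.zero_apply]

lemma centralDiff_prod_pow_self (α : Fin n → ℕ) :
    centralDiff α (fun x => ∏ i, x i ^ α i) = multiFactorial α := by
  rw [centralDiff_prod α fun i r => r ^ α i]
  simp only [fwdDiff_iter_eq_factorial, Pi.natCast_apply, multiFactorial, Nat.cast_prod]

lemma two_mul_sin_half (x : ℝ) : 2 * Real.sin (x / 2) = x * Real.sinc (x / 2) := by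
  rcases eq_or_ne x 0 with rfl | hx
  · simp
  · rw [Real.sinc_of_ne_zero (by positivity)]
    field_simp

lemma exp_I_mul_sub_one (y : ℝ) : Complex.exp (Complex.I * y) - 1 =
    Complex.I * y * Real.sinc (y / 2) * Complex.exp (y / 2 * Complex.I) := by
  have hsq : Complex.exp (Complex.I * y) = Complex.exp (y / 2 * Complex.I) ^ 2 := by
    rw [← Complex.exp_nat_mul]
    push_cast
    ring_nf
  have hsin : (y * Real.sinc (y / 2) : ℂ) = 2 * Complex.sin (y / 2) := by
    exact_mod_cast (two_mul_sin_half y).symm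
  rw [mul_assoc Complex.I, hsin, hsq, Complex.exp_mul_I]
  linear_combination Complex.sin_sq_add_cos_sq (y / 2 : ℂ) -
    Complex.sin (y / 2 : ℂ) ^ 2 * Complex.I_sq

lemma fwdDiff_iter_exp_I_mul (a : ℕ) (y : ℝ) :
    (fwdDiff (1 : ℝ))^[a] (fun r : ℝ => Complex.exp (Complex.I * y * r)) (-(a / 2)) =
      (Complex.I * y * Real.sinc (y / 2)) ^ a := by
  let χ : AddChar ℝ ℂ :=
    { toFun := fun r => Complex.exp (Complex.I * y * r)
      map_zero_eq_one' := by simp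
      map_add_eq_mul' := fun r r' => by rw [← Complex.exp_add]; push_cast; ring_nf }
  have hχ : Complex.exp (y / 2 * Complex.I) ^ a * χ (-(a / 2)) = 1 := by
    rw [← Complex.exp_nat_mul]
    change _ * Complex.exp _ = 1
    rw [← Complex.exp_add, Complex.exp_eq_one_iff]
    exact ⟨0, by push_cast; ring⟩
  change (fwdDiff (1 : ℝ))^[a] χ _ = _
  rw [fwdDiff_addChar_eq]
  change (Complex.exp _ - 1) ^ a * _ = _
  rw [Complex.ofReal_one, mul_one, exp_I_mul_sub_one, mul_pow, mul_assoc, hχ, mul_one]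

lemma centralDiff_charFun (μ : Measure (EuclideanSpace ℝ (Fin n))) [IsFiniteMeasure μ]
    (α : Fin n → ℕ) (h : ℝ) :
    centralDiff α (fun t => charFun μ (h • t)) = (Complex.I * h) ^ order α *
      ((∫ x, ∏ i, (x i * Real.sinc (h * x i / 2)) ^ α i ∂μ : ℝ) : ℂ) := by
  have hexp (x t : EuclideanSpace ℝ (Fin n)) : Complex.exp (inner ℝ x (h • t) * Complex.I) =
      ∏ i, Complex.exp (Complex.I * (h * x i : ℝ) * t i) := by
    rw [← Complex.exp_sum, PiLp.inner_apply]
    push_cast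
    rw [Finset.sum_mul]
    congr! 2 with i
    simp only [PiLp.smul_apply, smul_eq_mul, RCLike.inner_apply, Real.ringHom_apply,
      Complex.ofReal_mul]
    ring
  have hint (t : EuclideanSpace ℝ (Fin n)) :
      Integrable (fun x => Complex.exp (inner ℝ x (h • t) * Complex.I)) μ :=
    .of_bound (Continuous.aestronglyMeasurable (by fun_prop)) 1
      (.of_forall fun x => (Complex.norm_exp_ofReal_mul_I _).le)
  simp only [charFun_apply]
  rw [integral_centralDiff α hint, ← integral_complex_ofReal, ← integral_const_mul]
  refine integral_congr_ae (.of_forall fun x => ?_)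
  simp only [hexp]
  rw [centralDiff_prod α fun i (r : ℝ) => Complex.exp (Complex.I * (h * x i : ℝ) * r)]
  simp only [fwdDiff_iter_exp_I_mul, order, ← Finset.prod_pow_eq_pow_sum, Complex.ofReal_prod,
    ← Finset.prod_mul_distrib, Complex.ofReal_pow, ← mul_pow]
  congr! 2 with i
  push_cast
  ring

end CentralDifference

section MomentsOfCharFun

variable {n : ℕ} {s : (Fin n → ℕ) → ℝ}

lemma order_strictMono : StrictMono (order : (Fin n → ℕ) → ℕ) := Fintype.sum_strictMono

lemma centralDiff_term (α β : Fin n → ℕ) :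
    centralDiff α (fun t => term s (toComplex t) β) =
      Complex.I ^ order β * s β / multiFactorial β *
        ((centralDiff α fun t => ∏ i, t i ^ β i : ℝ) : ℂ) := by
  have h := map_centralDiff ((AddMonoidHom.mulLeft
    (Complex.I ^ order β * s β / multiFactorial β : ℂ)).comp Complex.ofRealHom.toAddMonoidHom) α
    (fun t => ∏ i, t i ^ β i)
  simpa [term, toComplex] using h

lemma centralDiff_term_of_not_le {α β : Fin n → ℕ} (h : ¬α ≤ β) :
    centralDiff α (fun t => term s (toComplex t) β) = 0 := by
  rw [centralDiff_term, centralDiff_prod_pow_of_not_le h, Complex.ofReal_zero, mul_zero]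

lemma centralDiff_term_self (α : Fin n → ℕ) :
    centralDiff α (fun t => term s (toComplex t) α) = Complex.I ^ order α * s α := by
  have h : (multiFactorial α : ℂ) ≠ 0 := by
    simp [multiFactorial, Finset.prod_ne_zero_iff, Nat.factorial_ne_zero]
  rw [centralDiff_term, centralDiff_prod_pow_self, Complex.ofReal_natCast,
    div_mul_cancel₀ _ h]

lemma hasSum_centralDiff_f (hs : IsEntire s) (α : Fin n → ℕ) (h : ℝ) :
    HasSum (fun β => (h : ℂ) ^ order β * centralDiff α fun t => term s (toComplex t) β)
      (centralDiff α fun t => f s (toComplex (h • t))) := by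
  have hscale (t : EuclideanSpace ℝ (Fin n)) (β : Fin n → ℕ) :
      (h : ℂ) ^ order β * term s (toComplex t) β = term s (toComplex (h • t)) β := by
    rw [← term_smul]
    congr 1
    ext i
    simp [toComplex]
  have hmul (β : Fin n → ℕ) := map_centralDiff (AddMonoidHom.mulLeft ((h : ℂ) ^ order β)) α
    fun t => term s (toComplex t) β
  simp only [AddMonoidHom.coe_mulLeft, hscale] at hmul
  simp only [← hmul]
  exact hasSum_centralDiff α fun t => (hs _).hasSum

lemma tendsto_centralDiff_f_div (hs : IsEntire s) (α : Fin n → ℕ) :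
    Tendsto (fun h : ℝ => (centralDiff α fun t => f s (toComplex (h • t))) / (h : ℂ) ^ order α)
      (𝓝[>] 0) (𝓝 (Complex.I ^ order α * s α)) := by
  let c (β : Fin n → ℕ) : ℂ := centralDiff α fun t => term s (toComplex t) β
  have hc_self : c α = Complex.I ^ order α * s α := centralDiff_term_self α
  have hc_not_le {β : Fin n → ℕ} (hle : ¬α ≤ β) : c β = 0 := centralDiff_term_of_not_le hle
  have hcont : ContinuousOn (fun h : ℝ => ∑' β, (h : ℂ) ^ (order β - order α) * c β)
      (Metric.closedBall 0 1) := by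
    refine continuousOn_tsum (u := fun β => ‖c β‖) (fun β => by fun_prop) ?_ fun β h hh => ?_
    · simpa using (hasSum_centralDiff_f hs α 1).summable.norm
    · rw [norm_mul, norm_pow, Complex.norm_real]
      exact mul_le_of_le_one_left (norm_nonneg _)
        (pow_le_one₀ (norm_nonneg _) (mem_closedBall_zero_iff.1 hh))
  have hzero : ∑' β, ((0 : ℝ) : ℂ) ^ (order β - order α) * c β = Complex.I ^ order α * s α := by
    rw [tsum_eq_single α, hc_self, Nat.sub_self, pow_zero, one_mul]
    intro β hβ
    by_cases hle : α ≤ β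
    · rw [Complex.ofReal_zero, zero_pow, zero_mul]
      exact (Nat.sub_pos_of_lt (order_strictMono (lt_of_le_of_ne hle hβ.symm))).ne'
    · rw [hc_not_le hle, mul_zero]
  have hlim := (hcont.continuousAt (Metric.closedBall_mem_nhds _ one_pos)).tendsto
  rw [hzero] at hlim
  refine (hlim.mono_left nhdsWithin_le_nhds).congr' ?_
  filter_upwards [self_mem_nhdsWithin] with h (hh : 0 < h)
  rw [← (hasSum_centralDiff_f hs α h).tsum_eq, ← tsum_div_const]
  refine tsum_congr fun β => ?_
  by_cases hle : α ≤ β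
  · rw [pow_sub₀ _ (Complex.ofReal_ne_zero.2 hh.ne') (order_strictMono.monotone hle)]
    ring
  · simp only [centralDiff_term_of_not_le hle, hc_not_le hle, mul_zero, zero_div]

variable {μ : Measure (EuclideanSpace ℝ (Fin n))} [IsFiniteMeasure μ]

lemma tendsto_integral_prod_sinc (hs : IsEntire s) (hμ : charFun μ = fun t => f s (toComplex t))
    (α : Fin n → ℕ) :
    Tendsto (fun h : ℝ => ∫ x, ∏ i, (x i * Real.sinc (h * x i / 2)) ^ α i ∂μ) (𝓝[>] 0)
      (𝓝 (s α)) := by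
  have hlim := (tendsto_centralDiff_f_div hs α).const_mul (Complex.I ^ order α)⁻¹
  rw [inv_mul_cancel_left₀ (pow_ne_zero _ Complex.I_ne_zero)] at hlim
  refine Tendsto.congr' ?_ ((Complex.continuous_re.tendsto _).comp hlim)
  filter_upwards [self_mem_nhdsWithin] with h (hh : 0 < h)
  have hh' : (h : ℂ) ≠ 0 := Complex.ofReal_ne_zero.2 hh.ne'
  simp only [funext_iff] at hμ
  simp only [Function.comp_apply, ← hμ, centralDiff_charFun]
  rw [mul_pow, mul_assoc, mul_div_assoc, inv_mul_cancel_left₀ (pow_ne_zero _ Complex.I_ne_zero),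
    mul_div_cancel_left₀ _ (pow_ne_zero _ hh'), Complex.ofReal_re]

lemma tendsto_prod_sinc (x : Fin n → ℝ) (α : Fin n → ℕ) :
    Tendsto (fun h : ℝ => ∏ i, (x i * Real.sinc (h * x i / 2)) ^ α i) (𝓝[>] 0)
      (𝓝 (∏ i, x i ^ α i)) := by
  have hcont : Continuous fun h : ℝ => ∏ i, (x i * Real.sinc (h * x i / 2)) ^ α i := by
    fun_prop
  simpa using (hcont.tendsto 0).mono_left nhdsWithin_le_nhds

lemma integrable_prod_sinc {h : ℝ} (hh : 0 < h) (α : Fin n → ℕ) :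
    Integrable (fun x : EuclideanSpace ℝ (Fin n) =>
      ∏ i, (x i * Real.sinc (h * x i / 2)) ^ α i) μ := by
  refine .of_bound (Continuous.aestronglyMeasurable (by fun_prop)) (∏ i, (2 / h) ^ α i)
    (.of_forall fun x => ?_)
  simp only [norm_prod, norm_pow]
  gcongr with i
  rw [le_div_iff₀ hh, ← Real.norm_of_nonneg hh.le, ← norm_mul, mul_right_comm, mul_comm _ h,
    Real.norm_of_nonneg hh.le, ← two_mul_sin_half, norm_mul, Real.norm_two]
  exact mul_le_of_le_one_right zero_le_two (Real.abs_sin_le_one _)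

lemma integrable_prod_pow_two_mul (hs : IsEntire s)
    (hμ : charFun μ = fun t => f s (toComplex t)) (α : Fin n → ℕ) :
    Integrable (fun x => ∏ i, x i ^ (2 * α) i) μ := by
  refine integrable_of_tendsto_integral_norm (l := 𝓝[>] (0 : ℝ))
    (eventually_mem_nhdsWithin.mono fun h hh => integrable_prod_sinc hh (2 * α))
    (.of_forall fun x => tendsto_prod_sinc x _)
    ((tendsto_integral_prod_sinc hs hμ (2 * α)).congr fun h => ?_)
  refine integral_congr_ae (.of_forall fun x => (Real.norm_of_nonneg ?_).symm)
  exact Finset.prod_nonneg fun i _ => (even_two_mul (α i)).pow_nonneg _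

lemma integrable_prod_pow (hs : IsEntire s) (hμ : charFun μ = fun t => f s (toComplex t))
    (α : Fin n → ℕ) : Integrable (fun x => ∏ i, x i ^ α i) μ := by
  have hsq : MemLp (fun x => ∏ i, x i ^ α i) 2 μ := by
    refine (memLp_two_iff_integrable_sq (Continuous.aestronglyMeasurable (by fun_prop))).2 ?_
    simpa [← Finset.prod_pow, ← pow_mul, mul_comm] using integrable_prod_pow_two_mul hs hμ α
  exact hsq.integrable one_le_two

theorem represents_of_charFun_eq (hs : IsEntire s)
    (hμ : charFun μ = fun t => f s (toComplex t)) : Represents μ s := by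
  intro α
  have hint := integrable_prod_pow hs hμ α
  refine ⟨hint, tendsto_nhds_unique ?_ (tendsto_integral_prod_sinc hs hμ α)⟩
  refine tendsto_integral_filter_of_dominated_convergence _
    (.of_forall fun h => Continuous.aestronglyMeasurable (by fun_prop))
    (.of_forall fun h => .of_forall fun x => ?_) hint.norm
    (.of_forall fun x => tendsto_prod_sinc x α)
  simp only [norm_prod, norm_pow, norm_mul]
  gcongr with i
  exact mul_le_of_le_one_right (norm_nonneg _) (Real.abs_sinc_le_one _)

end MomentsOfCharFun

section Parity

variable {n : ℕ} {s : (Fin n → ℕ) → ℝ}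

theorem isDeterminate_iff_isPosDefFun (hs0 : s 0 = 1) (hs : IsEntire s) :
    IsDeterminateMomentSequence s ↔ IsPosDefFun fun x => f s (toComplex x) := by
  constructor
  · rintro ⟨μ, hμ, -⟩
    have := hμ.isFiniteMeasure
    exact hμ.charFun_eq hs ▸ isPosDefFun_charFun μ
  · intro h
    obtain ⟨μ, hμ⟩ := h.exists_charFun_eq (continuous_f_toComplex hs)
      (by rw [f_toComplex_zero, hs0, Complex.ofReal_one])
    refine ⟨μ, represents_of_charFun_eq hs hμ, fun ν hν => ?_⟩
    have := hν.isFiniteMeasure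
    exact Measure.ext_of_charFun ((hν.charFun_eq hs).trans hμ.symm)

lemma term_neg (z : Fin n → ℂ) (α : Fin n → ℕ) :
    term s (-z) α = (-1) ^ order α * term s z α := by
  rw [← neg_one_smul ℂ z, term_smul]

lemma f₂_add_f₁ (hs : IsEntire s) (z : Fin n → ℂ) : f₂ s z + f₁ s z = f s z := by
  have h := Summable.tsum_add_tsum_compl (s := {α : Fin n → ℕ | Even (order α)})
    ((hs z).subtype _) ((hs z).subtype _)
  have hcompl : {α : Fin n → ℕ | Even (order α)}ᶜ = {α | Odd (order α)} := by
    ext α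
    exact Nat.not_even_iff_odd
  rwa [hcompl] at h

lemma f₁_neg (z : Fin n → ℂ) : f₁ s (-z) = -f₁ s z := by
  rw [f₁, f₁, ← tsum_neg]
  refine tsum_congr fun α => ?_
  rw [term_neg, α.2.neg_one_pow, neg_one_mul]

lemma f₂_neg (z : Fin n → ℂ) : f₂ s (-z) = f₂ s z := by
  refine tsum_congr fun α => ?_
  rw [term_neg, α.2.neg_one_pow, one_mul]

lemma differenceMatrix_neg {d : ℕ} (g : (Fin n → ℂ) → ℂ)
    (z : Fin d → EuclideanSpace ℝ (Fin n)) :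
    differenceMatrix g (-z) = differenceMatrix (fun w => g (-w)) z := by
  ext j k
  have h : toComplex (-z j - -z k) = -toComplex (z j - z k) := by
    ext i
    simp [toComplex, neg_add_eq_sub]
  exact congrArg g h

lemma differenceMatrix_f (hs : IsEntire s) {d : ℕ} (z : Fin d → EuclideanSpace ℝ (Fin n)) :
    differenceMatrix (f s) z = differenceMatrix (f₂ s) z + differenceMatrix (f₁ s) z := by
  ext j k
  exact (f₂_add_f₁ hs _).symm

lemma differenceMatrix_f_neg (hs : IsEntire s) {d : ℕ} (z : Fin d → EuclideanSpace ℝ (Fin n)) :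
    differenceMatrix (f s) (-z) = differenceMatrix (f₂ s) z - differenceMatrix (f₁ s) z := by
  rw [differenceMatrix_neg]
  ext j k
  simp [differenceMatrix, ← f₂_add_f₁ hs, f₁_neg, f₂_neg, sub_eq_add_neg]

end Parity

end BochnerTest

theorem theorem4p9 (n : ℕ) (s : (Fin n → ℕ) → ℝ) (hs0 : s 0 = 1)
    (hf : BochnerTest.IsEntire s) :
    List.TFAE [
      BochnerTest.IsDeterminateMomentSequence s,
      ∀ (d : ℕ) (z : Fin d → EuclideanSpace ℝ (Fin n)),
        (BochnerTest.differenceMatrix (BochnerTest.f s) z).PosSemidef,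
      ∀ (d : ℕ) (z : Fin d → EuclideanSpace ℝ (Fin n)),
        (BochnerTest.differenceMatrix (BochnerTest.f₂ s) z).PosSemidef ∧
        (BochnerTest.differenceMatrix (BochnerTest.f₂ s) z -
          BochnerTest.differenceMatrix (BochnerTest.f₁ s) z).PosSemidef] := by
  tfae_have 1 ↔ 2 := BochnerTest.isDeterminate_iff_isPosDefFun hs0 hf
  tfae_have 2 → 3 := by
    intro h d z
    have hadd := h d z
    have hsub := h d (-z)
    rw [BochnerTest.differenceMatrix_f hf] at hadd
    rw [BochnerTest.differenceMatrix_f_neg hf] at hsub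
    refine ⟨?_, hsub⟩
    convert (hadd.add hsub).smul (show (0 : ℝ) ≤ 1 / 2 by norm_num) using 1
    module
  tfae_have 3 → 2 := by
    intro h d z
    simpa only [← BochnerTest.differenceMatrix_f_neg hf, neg_neg] using (h d (-z)).2
  tfae_finish
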